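/- Let $K$ be a field, $S=K[x_1,\ldots,x_n]$ the polynomial ring with the standard grading ($n\ge 0$) and $\mathfrak m=(x_1,\ldots,x_n)$. For a finitely generated graded $S$-module $M=\bigoplus_{k\ge 0}M_k$ put $H_0(M,k)=\dim_K M_k$ and $H_{i+1}(M,k)=\sum_{j\le k}H_i(M,j)$ for $i\ge 0$. With $d=\dim M$ the Krull dimension of $M$ (put $d=0$ if $M=0$), the $i$th iterated Hilbert coefficients of $M$ are the integers $e^i_j(M)$, $0\le j\le d+i-1$, such that $$H_i(M,k)=\sum_{j=0}^{d+i-1}(-1)^j e^i_j(M)\binom{k+d+i-j-1}{d+i-j-1}\quad\text{for all } k\gg 0,$$ and $e^i_j(M)=0$ for $j>d+i-1$. Let $I\subset S$ be an ideal generated by homogeneous polynomials of one and the same degree, and let $\ell(I)=\dim \mathcal R(I)/\mathfrak m\mathcal R(I)$ be its analytic spread, where $\mathcal R(I)=\bigoplus_{k\ge 0}I^k$ is the Rees ring of $I$. Then the coefficients $e^i_j(I^k)$ are well defined for all $i,j,k\ge 0$, and for all $i,j\ge 0$ there is a polynomial $P\in\mathbb Q[x]$ of degree at most $\ell(I)+j-1$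 such that $e^i_j(I^k)=P(k)$ for all $k\gg 0$. Here the zero polynomial has degree $-1$. -/

import Mathlib

open Filter Polynomial

noncomputable section

namespace HilbertCoeff

section GradedModule

variable {K M : Type*} [Field K] [AddCommGroup M] [Module K M]

/-- The higher iterated Hilbert functions of a module `M = ⨁_{k ≥ 0} 𝓜 k` graded in nonnegative
degrees: `H_0(M, k) = dim_K 𝓜 k` and `H_{i+1}(M, k) = ∑_{j ≤ k} H_i(M, j)`. -/
def iteratedHilbertFunction (𝓜 : ℕ → Submodule K M) : ℕ → ℕ → ℕ
  | 0, k => Module.finrank K (𝓜 k)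
  | i + 1, k => ∑ j ∈ Finset.range (k + 1), iteratedHilbertFunction 𝓜 i j

/-- `P` is the `i`th Hilbert polynomial of `M = ⨁ 𝓜 k`: `H_i(M, k) = P(k)` for all `k ≫ 0`. -/
def IsIteratedHilbertPolynomial (𝓜 : ℕ → Submodule K M) (i : ℕ) (P : ℚ[X]) : Prop :=
  ∀ᶠ k : ℕ in atTop, (iteratedHilbertFunction 𝓜 i k : ℚ) = P.eval (k : ℚ)

end GradedModule

/-- The Krull dimension of an `R`-module as a natural number. It is meant for modules of finite
Krull dimension; the zero module (of dimension `-∞`) gets the value `0`. -/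
def moduleDim (R M : Type*) [CommRing R] [AddCommGroup M] [Module R M] : ℕ :=
  ((Module.supportDim R M).unbotD 0).toNat

section Coefficients

variable {K M : Type*} (R : Type*) [Field K] [CommRing R]
  [AddCommGroup M] [Module K M] [Module R M]

/-- The sequence `e` is the sequence of `i`th iterated Hilbert coefficients of the graded
`R`-module `M = ⨁ 𝓜 k`: with `d = dim M`, the `i`th Hilbert polynomial of `M` is
`∑_{j=0}^{d+i-1} (-1)^j e_j binom(x+d+i-j-1, d+i-j-1)`, and `e_j = 0` for `j > d+i-1`.
Here `Polynomial.preHilbertPoly ℚ r 0` is the polynomial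
`binom(x+r, r) = (x+1)(x+2)⋯(x+r)/r!`. -/
def IsHilbertCoeffs (𝓜 : ℕ → Submodule K M) (i : ℕ) (e : ℕ → ℤ) : Prop :=
  IsIteratedHilbertPolynomial 𝓜 i
    (∑ j ∈ Finset.range (moduleDim R M + i),
      C ((-1 : ℚ) ^ j * (e j : ℚ)) * preHilbertPoly ℚ (moduleDim R M + i - j - 1) 0) ∧
  ∀ j, moduleDim R M + i ≤ j → e j = 0

open Classical in
/-- The higher iterated Hilbert coefficient `e^i_j(M)` of the graded `R`-module `M = ⨁ 𝓜 k`,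
that is, the `j`th member of the sequence described by `IsHilbertCoeffs`
(and `0` if there is no such sequence). -/
def hilbertCoeff (𝓜 : ℕ → Submodule K M) (i j : ℕ) : ℤ :=
  if h : ∃ e : ℕ → ℤ, IsHilbertCoeffs R 𝓜 i e then h.choose j else 0

end Coefficients

section Ideals

variable {K : Type*} [Field K] {n : ℕ}

/-- The graded components `J ∩ S_d` of a graded ideal `J` of `S = K[x_1, …, x_n]`, as
`K`-subspaces of the `S`-module `J`. -/
def idealGrading (J : Ideal (MvPolynomial (Fin n) K)) (d : ℕ) : Submodule K J :=
  (MvPolynomial.homogeneousSubmodule (Fin n) K d).comap (J.subtype.restrictScalars K)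

/-- The ideal `I` is generated by homogeneous polynomials of degree `p`
(in particular it is a graded ideal). -/
def IsGeneratedInDegree (I : Ideal (MvPolynomial (Fin n) K)) (p : ℕ) : Prop :=
  ∃ G : Set (MvPolynomial (Fin n) K), (∀ f ∈ G, f.IsHomogeneous p) ∧ I = Ideal.span G

/-- The analytic spread of `I`: the Krull dimension of `ℛ(I) / 𝔪 ℛ(I)`, where `ℛ(I)` is the
Rees ring of `I` and `𝔪 = (x_1, …, x_n)`. -/
def analyticSpread (I : Ideal (MvPolynomial (Fin n) K)) : WithBot ℕ∞ :=
  ringKrullDim (reesAlgebra I ⧸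
    (MvPolynomial.idealOfVars (Fin n) K).map (algebraMap (MvPolynomial (Fin n) K) (reesAlgebra I)))

end Ideals

end HilbertCoeff

end

noncomputable section

namespace HilbertCoeff

/-! ### Lower sets in `ℕ^N` and rationality of their counting functions. -/

section Combinatorics

/-! Let f_1, …, f_r of degree p generate I. Give x_i bidegree (1, 0) and f_j bidegree (0, 1), as in
the Rees ring. Since all f_j have the same degree, the degree d part of I^k is spanned by the
monomials in the x_i and f_j of bidegree (d - pk, k). The monomials that are not combinations of
lexicographically smaller ones of the same bidegree have exponents forming a lower set, and counting
them gives the bigraded Hilbert function. The indicator of a lower set is a finite sum of products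
of eventually constant functions of one coordinate. Hence the Hilbert series of I^k is X^(pk) N_k /
(1 - X)^n with N_k = ∑_l B_l(k) p_l, where the polynomials p_l do not depend on k and each B_l is
eventually polynomial (`exists_finrank_bidegreeSpan`).

If I ≠ 0, then every I^k has dimension n, and for j < n + i the coefficient e^i_j(I^k) is the jth
Taylor coefficient at 1 of X^(pk) N_k (`isHilbertCoeffs_of_series`). By the product rule it is the
sum over a + b = j of binom(pk, a) times the bth Taylor coefficient of N_k. The binomial has degree
at most a ≤ j in k, so it remains to see that the Taylor coefficients of N_k have degree less than
ℓ(I).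

They are bounded by a constant times the dimension of the component of bidegree (0, k), which embeds
into the fiber ring ℛ(I)/𝔪ℛ(I) for degree reasons. Noether normalization bounds the partial sums of
these dimensions by O(k^s) with s ≤ ℓ(I) (`exists_sum_finrank_le_pow`), and `degree_lt_of_sum_le`
turns this into degree less than s. -/

/-- A descending chain of lower sets in a well-quasi-order is eventually constant. -/
theorem exists_forall_ge_eq_of_isLowerSet {α : Type*} [Preorder α] [WellQuasiOrderedLE α]
    (L : ℕ → Set α) (hL : ∀ c, IsLowerSet (L c)) (hanti : Antitone L) :
    ∃ c₀, ∀ c, c₀ ≤ c → L c = L c₀ := by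
  by_contra! h
  have h' : ∀ c₀, ∃ c a, c₀ ≤ c ∧ a ∈ L c₀ ∧ a ∉ L c := by
    intro c₀
    obtain ⟨c, hc, hne⟩ := h c₀
    obtain ⟨a, ha, ha'⟩ := Set.not_subset.1 (fun hs => hne ((hanti hc).antisymm hs))
    exact ⟨c, a, hc, ha, ha'⟩
  choose next pt hle hmem hnot using h'
  let s : ℕ → ℕ := fun i => Nat.rec 0 (fun _ c => next c) i
  have hs : ∀ i, s (i + 1) = next (s i) := fun i => rfl
  have hmono : Monotone s := monotone_nat_of_le_succ fun i => by rw [hs]; exact hle _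
  -- The point `pt (s i)` is lost between stages `s i` and `s (i + 1)`. If it lies below a later `pt
  -- (s j)`, which still belongs to stage `s (i + 1)`, then it was not lost.
  obtain ⟨i, j, hij, hle'⟩ := wellQuasiOrdered_le (α := α) (fun i => pt (s i))
  have h1 : pt (s j) ∈ L (s (i + 1)) := hanti (hmono hij) (hmem _)
  exact hnot (s i) (by rw [← hs]; exact hL _ hle' h1)

/-- The indicator function of a lower set in `ℕ^N` is a sum of products of eventually constant
functions of the coordinates. -/
theorem exists_indicator_eq_sum_prod (N : ℕ) (L : Set (Fin N → ℕ)) (hL : IsLowerSet L) :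
    ∃ (ι : Type) (_ : Fintype ι) (g : ι → Fin N → ℕ → ℤ),
      (∀ l i, ∃ c, ∀ᶠ k in atTop, g l i k = c) ∧
      ∀ a, L.indicator 1 a = ∑ l, ∏ i, g l i (a i) := by
  classical
  induction N with
  | zero =>
    by_cases h : (Fin.elim0 : Fin 0 → ℕ) ∈ L
    · refine ⟨Unit, inferInstance, fun _ i => i.elim0, fun _ i => i.elim0, fun a => ?_⟩
      rw [Subsingleton.elim a Fin.elim0]
      simp [h]
    · refine ⟨Empty, inferInstance, fun _ i => i.elim0, fun _ i => i.elim0, fun a => ?_⟩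
      rw [Subsingleton.elim a Fin.elim0]
      simp [h]
  | succ N ih =>
    have hsl : ∀ c, IsLowerSet {a : Fin N → ℕ | (Fin.cons c a : Fin (N + 1) → ℕ) ∈ L} :=
      fun c a b hba ha => hL (Fin.cons_le_cons.2 ⟨le_rfl, hba⟩) ha
    obtain ⟨c₀, hc₀⟩ := exists_forall_ge_eq_of_isLowerSet
      (fun c => {a : Fin N → ℕ | (Fin.cons c a : Fin (N + 1) → ℕ) ∈ L}) hsl
      (fun c d hcd a ha => hL (Fin.cons_le_cons.2 ⟨hcd, le_rfl⟩) ha)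
    choose ι hι g hg hsum using fun c => ih _ (hsl c)
    -- The slices by the first coordinate decrease and stabilize at `c₀`, so only the slices `0, …,
    -- c₀` matter. The first factor selects the slice `min k c₀` and is constant for `k ≥ c₀`.
    refine ⟨Σ c : Fin (c₀ + 1), ι c, inferInstance, fun l => Fin.cons
      (fun k => if min k c₀ = l.1 then 1 else 0) (g l.1 l.2), fun l i => ?_, fun a => ?_⟩
    · refine Fin.cases ?_ (fun i => ?_) i
      · refine ⟨if c₀ = l.1 then 1 else 0, ?_⟩
        filter_upwards [eventually_ge_atTop c₀] with k hk
        simp [min_eq_right hk]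
      · simpa using hg _ l.2 i
    · obtain ⟨c, a, rfl⟩ : ∃ c b, a = Fin.cons c b := ⟨a 0, Fin.tail a, by simp⟩
      have hc : (Fin.cons c a ∈ L) ↔ (Fin.cons (min c c₀) a : Fin (N + 1) → ℕ) ∈ L := by
        rcases le_total c c₀ with h | h
        · rw [min_eq_left h]
        · rw [min_eq_right h]
          exact Set.ext_iff.1 (hc₀ c h) a
      have hi : L.indicator (1 : (Fin (N + 1) → ℕ) → ℤ) (Fin.cons c a) =
          Set.indicator {a : Fin N → ℕ | (Fin.cons (min c c₀) a : Fin (N + 1) → ℕ) ∈ L} 1 a := by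
        simp only [Set.indicator_apply, hc, Set.mem_ofPred_eq, Pi.one_apply]
      rw [hi, hsum, Fintype.sum_sigma, Finset.sum_eq_single
        (⟨min c c₀, Nat.lt_succ_of_le (min_le_right _ _)⟩ : Fin (c₀ + 1))]
      · simp [Fin.prod_univ_succ]
      · intro b _ hb
        have : ¬ min c c₀ = b := fun h => hb (Fin.ext h.symm)
        simp [Fin.prod_univ_succ, this]
      · simp

theorem exists_one_sub_X_mul_mk_eq {g : ℕ → ℤ} (hg : ∃ c, ∀ᶠ k in atTop, g k = c) :
    ∃ q : ℤ[X], (1 - PowerSeries.X) * PowerSeries.mk g = (q : PowerSeries ℤ) := by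
  obtain ⟨c, hc⟩ := hg
  obtain ⟨N, hN⟩ := eventually_atTop.1 hc
  -- The coefficients of the product are the differences `g k - g (k - 1)`, which vanish for `k >
  -- N`.
  refine ⟨PowerSeries.trunc (N + 1) ((1 - PowerSeries.X) * PowerSeries.mk g), ?_⟩
  ext k
  rw [Polynomial.coeff_coe, PowerSeries.coeff_trunc]
  split_ifs with h
  · rfl
  · obtain ⟨k, rfl⟩ : ∃ k', k = k' + 1 := ⟨k - 1, by omega⟩
    rw [sub_mul, one_mul, map_sub, PowerSeries.coeff_succ_X_mul]
    simp [hN k (by omega), hN (k + 1) (by omega)]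

theorem coeff_prod_mk {R : Type*} [CommSemiring R] {n : ℕ} (g : Fin n → ℕ → R) (m : ℕ) :
    PowerSeries.coeff m (∏ i, PowerSeries.mk (g i)) =
      ∑ a ∈ Finset.finAntidiagonal n m, ∏ i, g i (a i) := by
  rw [PowerSeries.coeff_prod]
  refine Finset.sum_nbij' (fun l => ⇑l) (fun a => Finsupp.equivFunOnFinite.symm a) ?_ ?_ ?_ ?_ ?_
  · intro l hl
    simpa using hl
  · intro l hl
    simpa using hl
  · intro l _
    ext; simp
  · intro l _
    simp
  · intro l _
    simp

theorem exists_one_sub_X_pow_mul_prod_mk_eq {n : ℕ} {g : Fin n → ℕ → ℤ}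
    (hg : ∀ i, ∃ c, ∀ᶠ k in atTop, g i k = c) :
    ∃ q : ℤ[X], (1 - PowerSeries.X) ^ n * ∏ i, PowerSeries.mk (g i) = (q : PowerSeries ℤ) := by
  choose q hq using fun i => exists_one_sub_X_mul_mk_eq (hg i)
  refine ⟨∏ i, q i, ?_⟩
  have : ((∏ i, q i : ℤ[X]) : PowerSeries ℤ) = ∏ i, (q i : PowerSeries ℤ) :=
    map_prod (Polynomial.coeToPowerSeries.ringHom (R := ℤ)) q Finset.univ
  rw [this, ← Finset.prod_congr rfl fun i _ => hq i, Finset.prod_mul_distrib]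
  simp

/-- The exponents of bidegree `(m, k)`. -/
def bidegreeFinset (n r m k : ℕ) : Finset (Fin (n + r) → ℕ) :=
  (Finset.finAntidiagonal n m ×ˢ Finset.finAntidiagonal r k).map (Fin.appendEquiv n r).toEmbedding

theorem mem_bidegreeFinset {n r m k : ℕ} {c : Fin (n + r) → ℕ} :
    c ∈ bidegreeFinset n r m k ↔
      ∑ i, c (Fin.castAdd r i) = m ∧ ∑ j, c (Fin.natAdd n j) = k := by
  rw [bidegreeFinset, Finset.mem_map_equiv]
  simp [Fin.appendEquiv]

/-- If a power of `1 - X` times the generating function of `B` is a polynomial, then `B` agrees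
with a polynomial function for large arguments. -/
theorem exists_eventually_eq_eval {B : ℕ → ℤ} {r : ℕ} {q : ℤ[X]}
    (h : (1 - PowerSeries.X) ^ r * PowerSeries.mk B = (q : PowerSeries ℤ)) :
    ∃ b : ℚ[X], ∀ᶠ k : ℕ in atTop, (B k : ℚ) = b.eval (k : ℚ) := by
  refine ⟨hilbertPoly (q.map (Int.castRingHom ℚ)) r, ?_⟩
  filter_upwards [eventually_gt_atTop (q.map (Int.castRingHom ℚ)).natDegree] with k hk
  rw [← coeff_mul_invOneSubPow_eq_hilbertPoly_eval r hk]
  have h2 := congrArg (PowerSeries.map (Int.castRingHom ℚ)) h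
  rw [map_mul, map_pow, map_sub, map_one, PowerSeries.map_X, ← Polynomial.polynomial_map_coe] at h2
  rw [← h2, mul_right_comm, ← PowerSeries.invOneSubPow_inv_eq_one_sub_pow]
  simp

/-- Counting the elements of given bidegree in a lower set. -/
theorem exists_count_lowerSet {n r : ℕ} (L : Set (Fin (n + r) → ℕ)) (hL : IsLowerSet L)
    [DecidablePred (· ∈ L)] :
    ∃ (ι : Type) (_ : Fintype ι) (p : ι → ℤ[X]) (B : ι → ℕ → ℤ) (b : ι → ℚ[X]),
      (∀ l, ∀ᶠ k : ℕ in atTop, (B l k : ℚ) = (b l).eval (k : ℚ)) ∧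
      ∀ k, (1 - PowerSeries.X) ^ n *
        PowerSeries.mk (fun m => (({c ∈ bidegreeFinset n r m k | c ∈ L}.card : ℕ) : ℤ)) =
        ((∑ l, B l k • p l : ℤ[X]) : PowerSeries ℤ) := by
  classical
  obtain ⟨ι, hι, g, hg, hsum⟩ := exists_indicator_eq_sum_prod _ L hL
  choose p hp using fun l => exists_one_sub_X_pow_mul_prod_mk_eq
    (fun i : Fin n => hg l (Fin.castAdd r i))
  choose q hq using fun l => exists_one_sub_X_pow_mul_prod_mk_eq
    (fun i : Fin r => hg l (Fin.natAdd n i))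
  -- Each summand of the indicator factors into a part in the first `n` coordinates, giving the
  -- numerator `p l`, and a part in the last `r`, contributing the number `B l k`.
  let B : ι → ℕ → ℤ := fun l k => PowerSeries.coeff k
    (∏ j, PowerSeries.mk (g l (Fin.natAdd n j)))
  have hB : ∀ l, PowerSeries.mk (B l) = ∏ j, PowerSeries.mk (g l (Fin.natAdd n j)) :=
    fun l => by ext; simp [B]
  choose b hb using fun l => exists_eventually_eq_eval ((hB l).symm ▸ hq l)
  refine ⟨ι, hι, p, B, b, hb, fun k => ?_⟩
  have hcount : PowerSeries.mk
      (fun m => (({c ∈ bidegreeFinset n r m k | c ∈ L}.card : ℕ) : ℤ)) =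
      ∑ l, B l k • ∏ i, PowerSeries.mk (g l (Fin.castAdd r i)) := by
    ext m
    rw [PowerSeries.coeff_mk, map_sum]
    have h1 : (({c ∈ bidegreeFinset n r m k | c ∈ L}.card : ℕ) : ℤ) =
        ∑ c ∈ bidegreeFinset n r m k, L.indicator 1 c := by
      simp [Set.indicator_apply]
    rw [h1, Finset.sum_congr rfl fun c _ => hsum c, Finset.sum_comm]
    refine Finset.sum_congr rfl fun l _ => ?_
    rw [map_smul, coeff_prod_mk, smul_eq_mul]
    simp only [B]
    rw [coeff_prod_mk, bidegreeFinset, Finset.sum_map, Finset.sum_product, mul_comm,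
      Finset.sum_mul_sum]
    refine Finset.sum_congr rfl fun a _ => Finset.sum_congr rfl fun b _ => ?_
    simp [Fin.appendEquiv, Fin.prod_univ_add]
  have hcast : ((∑ l, B l k • p l : ℤ[X]) : PowerSeries ℤ) =
      ∑ l, B l k • (p l : PowerSeries ℤ) := by
    have h := map_sum (Polynomial.coeToPowerSeries.ringHom (R := ℤ)) (fun l => B l k • p l)
      Finset.univ
    simp only [map_zsmul] at h
    exact h
  rw [hcount, hcast, Finset.mul_sum]
  refine Finset.sum_congr rfl fun l _ => ?_
  rw [mul_smul_comm, hp]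

end Combinatorics

/-! ### Standard monomials and bigraded Hilbert functions. -/

section Monomials

open Classical in
/-- The rank of a finite family of vectors is the number of its members that do not lie in the
span of the preceding ones. -/
theorem finrank_span_image_eq_card {K V α β : Type*} [Field K] [AddCommGroup V] [Module K V]
    [LinearOrder β] (key : α → β) (hkey : Function.Injective key) (v : α → V) (D : Finset α) :
    Module.finrank K (Submodule.span K (v '' D)) =
      {a ∈ D | v a ∉ Submodule.span K (v '' {b | b ∈ D ∧ key b < key a})}.card := by
  induction D using Finset.induction_on_max_value key with
  | empty =>
    rw [Finset.coe_empty, Set.image_empty, Submodule.span_empty, finrank_bot]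
    simp
  | insert a s ha hmax ih =>
    have h1 : {b | b ∈ insert a s ∧ key b < key a} = (s : Set α) := by
      ext b
      simp only [Finset.mem_insert, Set.mem_ofPred_eq, Finset.mem_coe]
      constructor
      · rintro ⟨rfl | h, h'⟩
        · exact absurd h' (lt_irrefl _)
        · exact h
      · exact fun h => ⟨Or.inr h, lt_of_le_of_ne (hmax b h) fun h' => ha (hkey h' ▸ h)⟩
    have h2 : ∀ c ∈ s, {b | b ∈ insert a s ∧ key b < key c} = {b | b ∈ s ∧ key b < key c} := by
      intro c hc
      ext b
      simp only [Finset.mem_insert, Set.mem_ofPred_eq]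
      constructor
      · rintro ⟨rfl | h, h'⟩
        · exact absurd h' (not_lt.2 (hmax c hc))
        · exact ⟨h, h'⟩
      · exact fun h => ⟨Or.inr h.1, h.2⟩
    have h3 : {c ∈ s | v c ∉ Submodule.span K (v '' {b | b ∈ insert a s ∧ key b < key c})} =
        {c ∈ s | v c ∉ Submodule.span K (v '' {b | b ∈ s ∧ key b < key c})} :=
      Finset.filter_congr fun c hc => by rw [h2 c hc]
    have : FiniteDimensional K (Submodule.span K (v '' s)) :=
      FiniteDimensional.span_of_finite K (s.finite_toSet.image v)
    rw [Finset.filter_insert, h3, h1, Finset.coe_insert, Set.image_insert_eq]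
    split_ifs with h
    · rw [← ih, Submodule.span_insert_eq_span h]
    · rw [Finset.card_insert_of_notMem (by simp [ha]), ← ih, Submodule.span_insert, sup_comm]
      have hinf : Submodule.span K (v '' s) ⊓ Submodule.span K {v a} = ⊥ := by
        rw [← disjoint_iff, Submodule.disjoint_span_singleton']
        · exact h
        · rintro h0
          exact h (h0 ▸ Submodule.zero_mem _)
      have := Submodule.finrank_sup_add_finrank_inf_eq (Submodule.span K (v '' s))
        (Submodule.span K {v a})
      rw [hinf, finrank_bot, add_zero, finrank_span_singleton] at this
      · exact this
      · rintro h0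
        exact h (h0 ▸ Submodule.zero_mem _)

variable {K A : Type*} [Field K] [CommRing A] [Algebra K A]

/-- The product `∏ z_i ^ c_i`. -/
def monom {N : ℕ} (z : Fin N → A) (c : Fin N → ℕ) : A := ∏ i, z i ^ c i

theorem monom_add {N : ℕ} (z : Fin N → A) (c d : Fin N → ℕ) :
    monom z (c + d) = monom z c * monom z d := by
  simp [monom, pow_add, Finset.prod_mul_distrib]

theorem monom_append {n r : ℕ} (x : Fin n → A) (f : Fin r → A) (c : Fin (n + r) → ℕ) :
    monom (Fin.append x f) c =
      monom x (fun i => c (Fin.castAdd r i)) * monom f (fun j => c (Fin.natAdd n j)) := by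
  simp [monom, Fin.prod_univ_add]

/-- The exponents of bidegree `(m, k)` preceding `c` in the lexicographic order. -/
def bidegreeBelow (n r : ℕ) (c : Fin (n + r) → ℕ) : Set (Fin (n + r) → ℕ) :=
  {b | (∑ i, b (Fin.castAdd r i) = ∑ i, c (Fin.castAdd r i) ∧
    ∑ j, b (Fin.natAdd n j) = ∑ j, c (Fin.natAdd n j)) ∧ toLex b < toLex c}

/-- The exponents of those monomials in `z` that are not linear combinations of preceding
monomials of the same bidegree. -/
def standardExponents (K : Type*) {A : Type*} [Field K] [CommRing A] [Algebra K A] {n r : ℕ}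
    (z : Fin (n + r) → A) : Set (Fin (n + r) → ℕ) :=
  {c | monom z c ∉ Submodule.span K (monom z '' bidegreeBelow n r c)}

/-- The lexicographic order is compatible with addition: multiplying a relation that expresses a
monomial through smaller ones by a further monomial gives a relation of the same kind. So multiples
of nonstandard monomials are nonstandard. -/
theorem isLowerSet_standardExponents {n r : ℕ} (z : Fin (n + r) → A) :
    IsLowerSet (standardExponents K z) := by
  intro c d hdc hc hd
  obtain ⟨e, rfl⟩ : ∃ e, c = d + e := ⟨c - d, (add_tsub_cancel_of_le hdc).symm⟩
  refine hc ?_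
  rw [monom_add]
  have h1 : monom z d * monom z e ∈
      (Submodule.span K (monom z '' bidegreeBelow n r d)).map (LinearMap.mulRight K (monom z e)) :=
    ⟨_, hd, rfl⟩
  rw [Submodule.map_span] at h1
  refine Submodule.span_mono ?_ h1
  rintro _ ⟨_, ⟨b, ⟨⟨hb1, hb2⟩, hb3⟩, rfl⟩, rfl⟩
  refine ⟨b + e, ⟨⟨?_, ?_⟩, ?_⟩, ?_⟩
  · simp [Finset.sum_add_distrib, hb1]
  · simp [Finset.sum_add_distrib, hb2]
  · rw [toLex_add, toLex_add]
    exact add_lt_add_left hb3 _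
  · simp [monom_add]

/-- The span of all monomials in `z` of bidegree `(m, k)`. -/
def bidegreeSpan (K : Type*) {A : Type*} [Field K] [CommRing A] [Algebra K A] {n r : ℕ}
    (z : Fin (n + r) → A) (m k : ℕ) : Submodule K A :=
  Submodule.span K (monom z '' bidegreeFinset n r m k)

instance {n r : ℕ} (z : Fin (n + r) → A) (m k : ℕ) :
    FiniteDimensional K (bidegreeSpan K z m k) :=
  FiniteDimensional.span_of_finite K ((Finset.finite_toSet _).image _)

open Classical in
theorem finrank_bidegreeSpan {n r : ℕ} (z : Fin (n + r) → A) (m k : ℕ) :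
    Module.finrank K (bidegreeSpan K z m k) =
      {c ∈ bidegreeFinset n r m k | c ∈ standardExponents K z}.card := by
  rw [bidegreeSpan, finrank_span_image_eq_card toLex toLex.injective]
  congr 1
  refine Finset.filter_congr fun c hc => ?_
  have : {b | b ∈ bidegreeFinset n r m k ∧ toLex b < toLex c} = bidegreeBelow n r c := by
    ext b
    obtain ⟨h1, h2⟩ := mem_bidegreeFinset.1 hc
    simp [bidegreeBelow, mem_bidegreeFinset, h1, h2]
  change _ ↔ monom z c ∉ Submodule.span K (monom z '' bidegreeBelow n r c)
  rw [← this]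
  rfl

/-- The bigraded Hilbert series of a standard bigraded algebra is rational. -/
theorem exists_finrank_bidegreeSpan {n r : ℕ} (z : Fin (n + r) → A) :
    ∃ (ι : Type) (_ : Fintype ι) (p : ι → ℤ[X]) (B : ι → ℕ → ℤ) (b : ι → ℚ[X]),
      (∀ l, ∀ᶠ k : ℕ in atTop, (B l k : ℚ) = (b l).eval (k : ℚ)) ∧
      ∀ k, (1 - PowerSeries.X) ^ n *
        PowerSeries.mk (fun m => (Module.finrank K (bidegreeSpan K z m k) : ℤ)) =
        ((∑ l, B l k • p l : ℤ[X]) : PowerSeries ℤ) := by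
  classical
  simp only [finrank_bidegreeSpan]
  exact exists_count_lowerSet _ (isLowerSet_standardExponents z)

end Monomials

/-! ### Powers of an ideal generated in one degree. -/

section Powers

variable {K : Type*} [Field K] {n r : ℕ}

theorem IsGeneratedInDegree.exists_fin {I : Ideal (MvPolynomial (Fin n) K)} {p : ℕ}
    (hI : IsGeneratedInDegree I p) :
    ∃ (r : ℕ) (f : Fin r → MvPolynomial (Fin n) K), (∀ j, (f j).IsHomogeneous p) ∧
      I = Ideal.span (Set.range f) := by
  obtain ⟨G, hG, rfl⟩ := hI
  obtain ⟨t, htG, ht⟩ := (Submodule.fg_span_iff_fg_span_finset_subset G).1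
    (IsNoetherian.noetherian (Ideal.span G))
  refine ⟨t.card, fun j => (t.equivFin.symm j : MvPolynomial (Fin n) K),
    fun j => hG _ (htG (t.equivFin.symm j).2), ?_⟩
  have : Set.range (fun j => (t.equivFin.symm j : MvPolynomial (Fin n) K)) = t := by
    have h := t.equivFin.symm.surjective.range_comp (Subtype.val : t → MvPolynomial (Fin n) K)
    rw [Subtype.range_coe] at h
    exact h
  rw [this]
  exact ht

/-- The generators of the Rees algebra: the variables and the generators `f` of the ideal. -/
def reesGenerators (f : Fin r → MvPolynomial (Fin n) K) :
    Fin (n + r) → MvPolynomial (Fin n) K :=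
  Fin.append MvPolynomial.X f

theorem monom_mem_span_pow {A : Type*} [CommRing A] (f : Fin r → A) (b : Fin r → ℕ) :
    monom f b ∈ Ideal.span (Set.range f) ^ ∑ j, b j := by
  rw [monom, ← Finset.prod_pow_eq_pow_sum]
  exact Ideal.prod_mem_prod fun j _ => Ideal.pow_mem_pow (Ideal.subset_span (Set.mem_range_self j)) _

theorem mul_mem_span_monom {A : Type*} [CommRing A] [Algebra K A] {N : ℕ} (z : Fin N → A)
    {s t : Set (Fin N → ℕ)} (i : Fin N) (h : ∀ c ∈ s, c + Pi.single i 1 ∈ t) {y : A}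
    (hy : y ∈ Submodule.span K (monom z '' s)) : z i * y ∈ Submodule.span K (monom z '' t) := by
  have h1 : z i * y ∈ (Submodule.span K (monom z '' s)).map (LinearMap.mulLeft K (z i)) :=
    ⟨_, hy, rfl⟩
  rw [Submodule.map_span] at h1
  refine Submodule.span_mono ?_ h1
  rintro _ ⟨_, ⟨c, hc, rfl⟩, rfl⟩
  refine ⟨_, h c hc, ?_⟩
  have : monom z (Pi.single i 1) = z i := by
    rw [monom, Finset.prod_eq_single i] <;> simp +contextual
  rw [monom_add, this, mul_comm]
  rfl

/-- The spanning set is stable under multiplication by the variables, so its `K`-span is already an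
ideal. Multiplication by a generator raises the second degree by one. -/
theorem restrictScalars_span_pow (f : Fin r → MvPolynomial (Fin n) K) (k : ℕ) :
    (Ideal.span (Set.range f) ^ k).restrictScalars K = Submodule.span K
      (monom (reesGenerators f) '' {c | ∑ j, c (Fin.natAdd n j) = k}) := by
  apply le_antisymm
  · have hsmul : ∀ k, ∀ y ∈ Submodule.span K
        (monom (reesGenerators f) '' {c | ∑ j, c (Fin.natAdd n j) = k}), ∀ g,
        g * y ∈ Submodule.span K
          (monom (reesGenerators f) '' {c | ∑ j, c (Fin.natAdd n j) = k}) := by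
      intro k y hy g
      induction g using MvPolynomial.induction_on with
      | C a =>
        rw [← MvPolynomial.smul_eq_C_mul]
        exact Submodule.smul_mem _ _ hy
      | add g h hg hh =>
        rw [add_mul]
        exact Submodule.add_mem _ hg hh
      | mul_X g i hg =>
        have h1 := mul_mem_span_monom (reesGenerators f) (t := {c | ∑ j, c (Fin.natAdd n j) = k})
          (Fin.castAdd r i) (fun c hc => ?_) hg
        · rw [reesGenerators, Fin.append_left] at h1
          rw [mul_right_comm, mul_comm]
          exact h1
        · have : ∀ j, (Pi.single (Fin.castAdd r i) 1 : Fin (n + r) → ℕ) (Fin.natAdd n j) = 0 := by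
            intro j
            rw [Pi.single_apply, if_neg]
            intro h
            have := congrArg Fin.val h
            simp at this
            omega
          simpa [Finset.sum_add_distrib, this] using hc
    induction k with
    | zero =>
      intro y _
      have h1 : (1 : MvPolynomial (Fin n) K) ∈ Submodule.span K
          (monom (reesGenerators f) '' {c | ∑ j, c (Fin.natAdd n j) = 0}) :=
        Submodule.subset_span ⟨0, by simp, by simp [monom]⟩
      simpa using hsmul 0 1 h1 y
    | succ k ih =>
      intro y hy
      rw [Submodule.restrictScalars_mem, pow_succ'] at hy
      induction hy using Submodule.mul_induction_on' with
      | add x _ y _ hx hy => exact Submodule.add_mem _ hx hy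
      | mem_mul_mem x hx y hy =>
        have hy' := ih hy
        induction hx using Submodule.span_induction with
        | zero => simp
        | add a b _ _ ha hb =>
          rw [add_mul]
          exact Submodule.add_mem _ ha hb
        | smul a x _ hx =>
          rw [smul_mul_assoc]
          exact hsmul _ _ hx a
        | mem x hx =>
          obtain ⟨j, rfl⟩ := hx
          have h1 := mul_mem_span_monom (reesGenerators f)
            (t := {c | ∑ j, c (Fin.natAdd n j) = k + 1}) (Fin.natAdd n j) (fun c hc => ?_) hy'
          · rw [reesGenerators, Fin.append_right] at h1
            exact h1
          · have : ∀ i, (Pi.single (Fin.natAdd n j) 1 : Fin (n + r) → ℕ) (Fin.natAdd n i) =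
                if i = j then 1 else 0 := by
              intro i
              rw [Pi.single_apply]
              simp
            rw [Set.mem_ofPred_eq] at hc
            simp [Finset.sum_add_distrib, this, hc]
  · rw [Submodule.span_le]
    rintro _ ⟨c, rfl, rfl⟩
    rw [reesGenerators, monom_append]
    exact Ideal.mul_mem_left _ _ (monom_mem_span_pow _ _)

/-- The component of degree `d` of the span of homogeneous elements is the span of those
of degree `d`. -/
theorem span_image_inf_homogeneousSubmodule {α : Type*} (v : α → MvPolynomial (Fin n) K)
    (δ : α → ℕ) (hv : ∀ a, (v a).IsHomogeneous (δ a)) (s : Set α) (d : ℕ) :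
    Submodule.span K (v '' s) ⊓ MvPolynomial.homogeneousSubmodule (Fin n) K d =
      Submodule.span K (v '' {a | a ∈ s ∧ δ a = d}) := by
  apply le_antisymm
  · rintro y ⟨hy, hyd⟩
    have h1 : MvPolynomial.homogeneousComponent d y ∈
        (Submodule.span K (v '' s)).map (MvPolynomial.homogeneousComponent d) := ⟨y, hy, rfl⟩
    rw [MvPolynomial.homogeneousComponent_of_mem hyd, if_pos rfl, Submodule.map_span] at h1
    refine Submodule.span_le.2 ?_ h1
    rintro _ ⟨_, ⟨a, ha, rfl⟩, rfl⟩
    rw [MvPolynomial.homogeneousComponent_of_mem (hv a)]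
    split_ifs with h
    · exact Submodule.subset_span ⟨a, ⟨ha, h.symm⟩, rfl⟩
    · exact Submodule.zero_mem _
  · rw [Submodule.span_le]
    rintro _ ⟨a, ⟨ha, rfl⟩, rfl⟩
    exact ⟨Submodule.subset_span ⟨a, ha, rfl⟩, hv a⟩

theorem isHomogeneous_monom {N : ℕ} {z : Fin N → MvPolynomial (Fin n) K} {w : Fin N → ℕ}
    (hz : ∀ i, (z i).IsHomogeneous (w i)) (c : Fin N → ℕ) :
    (monom z c).IsHomogeneous (∑ i, w i * c i) :=
  MvPolynomial.IsHomogeneous.prod _ _ _ fun i _ => (hz i).pow _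

theorem isHomogeneous_monom_reesGenerators {f : Fin r → MvPolynomial (Fin n) K} {p : ℕ}
    (hf : ∀ j, (f j).IsHomogeneous p) (c : Fin (n + r) → ℕ) :
    (monom (reesGenerators f) c).IsHomogeneous
      (∑ i, c (Fin.castAdd r i) + p * ∑ j, c (Fin.natAdd n j)) := by
  rw [reesGenerators, monom_append]
  refine MvPolynomial.IsHomogeneous.mul ?_ ?_
  · simpa using isHomogeneous_monom (fun i => MvPolynomial.isHomogeneous_X K i)
      (fun i => c (Fin.castAdd r i))
  · simpa [Finset.mul_sum] using isHomogeneous_monom hf (fun j => c (Fin.natAdd n j))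

theorem finrank_idealGrading (J : Ideal (MvPolynomial (Fin n) K)) (d : ℕ) :
    Module.finrank K (idealGrading J d) = Module.finrank K
      (J.restrictScalars K ⊓ MvPolynomial.homogeneousSubmodule (Fin n) K d :
        Submodule K (MvPolynomial (Fin n) K)) := by
  have h := LinearEquiv.finrank_eq (Submodule.equivMapOfInjective
    (J.subtype.restrictScalars K) Subtype.val_injective (idealGrading J d))
  have h2 : (J.subtype.restrictScalars K).range = J.restrictScalars K := by
    ext x
    simp
  rw [h, idealGrading, Submodule.map_comap_eq, h2]

/-- Generation in a single degree enters here: a monomial of bidegree `(m, k)` is a form of degree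
`m + p * k`, so fixing `k` and the total degree fixes the bidegree. -/
theorem restrictScalars_span_pow_inf (f : Fin r → MvPolynomial (Fin n) K) {p : ℕ}
    (hf : ∀ j, (f j).IsHomogeneous p) (k d : ℕ) :
    (Ideal.span (Set.range f) ^ k).restrictScalars K ⊓
      MvPolynomial.homogeneousSubmodule (Fin n) K d =
    if p * k ≤ d then bidegreeSpan K (reesGenerators f) (d - p * k) k else ⊥ := by
  rw [restrictScalars_span_pow, span_image_inf_homogeneousSubmodule _ _
    (isHomogeneous_monom_reesGenerators hf)]
  split_ifs with h
  · rw [bidegreeSpan]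
    congr 2
    ext c
    simp only [Set.mem_ofPred_eq, Finset.mem_coe, mem_bidegreeFinset]
    constructor
    · rintro ⟨rfl, h2⟩
      exact ⟨by omega, rfl⟩
    · rintro ⟨h1, rfl⟩
      exact ⟨rfl, by omega⟩
  · rw [Submodule.span_eq_bot]
    rintro _ ⟨c, ⟨rfl, rfl⟩, rfl⟩
    exact absurd (Nat.le_add_left _ _) h

theorem mk_finrank_idealGrading (f : Fin r → MvPolynomial (Fin n) K) {p : ℕ}
    (hf : ∀ j, (f j).IsHomogeneous p) (k : ℕ) :
    PowerSeries.mk (fun d => (Module.finrank K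
        (idealGrading (Ideal.span (Set.range f) ^ k) d) : ℤ)) =
      PowerSeries.X ^ (p * k) * PowerSeries.mk
        (fun m => (Module.finrank K (bidegreeSpan K (reesGenerators f) m k) : ℤ)) := by
  ext d
  rw [PowerSeries.coeff_mk, PowerSeries.coeff_X_pow_mul', finrank_idealGrading,
    restrictScalars_span_pow_inf f hf]
  split_ifs with h
  · rw [if_pos h, PowerSeries.coeff_mk]
  · rw [if_neg h, finrank_bot, Nat.cast_zero]

end Powers

/-! ### Hilbert coefficients as Taylor coefficients of the numerator of the Hilbert series. -/

section HilbertCoefficients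

variable {K M : Type*} [Field K] [AddCommGroup M] [Module K M]

/-- Taking partial sums amounts to dividing the generating function by `1 - X`. -/
theorem one_sub_X_pow_mul_mk_iteratedHilbertFunction (𝓜 : ℕ → Submodule K M) (i : ℕ) :
    (1 - PowerSeries.X) ^ i * PowerSeries.mk (fun k => (iteratedHilbertFunction 𝓜 i k : ℤ)) =
      PowerSeries.mk (fun k => (Module.finrank K (𝓜 k) : ℤ)) := by
  induction i with
  | zero => simp [iteratedHilbertFunction]
  | succ i ih =>
    rw [← ih, pow_succ, mul_assoc]
    congr 1
    ext k
    rw [sub_mul, one_mul, map_sub]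
    cases k with
    | zero => simp [iteratedHilbertFunction]
    | succ k =>
      rw [PowerSeries.coeff_succ_X_mul]
      simp only [PowerSeries.coeff_mk, iteratedHilbertFunction]
      rw [Finset.sum_range_succ _ (k + 1)]
      push_cast
      ring

/-- For `j ≥ D` the fraction is a polynomial, so its coefficients are eventually zero. -/
theorem hilbertPoly_one_sub_X_pow (D j : ℕ) :
    hilbertPoly ((1 - X : ℚ[X]) ^ j) D = if j < D then preHilbertPoly ℚ (D - j - 1) 0 else 0 := by
  split_ifs with h
  · obtain ⟨d, rfl⟩ : ∃ d, D = d + 1 + j := ⟨D - j - 1, by omega⟩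
    have h1 := hilbertPoly_mul_one_sub_pow_add (1 : ℚ[X]) (d + 1) j
    rw [one_mul] at h1
    rw [h1, ← pow_zero X, hilbertPoly_X_pow_succ]
    congr 1
    omega
  · obtain ⟨e, rfl⟩ : ∃ e, j = e + D := ⟨j - D, by omega⟩
    have h1 := hilbertPoly_mul_one_sub_pow_add ((1 - X : ℚ[X]) ^ e) 0 D
    rw [← pow_add, zero_add] at h1
    rw [h1, hilbertPoly_zero_right]

/-- The Hilbert polynomial of `Q / (1 - X) ^ D` in terms of the Taylor coefficients of `Q` at `1`. -/
theorem hilbertPoly_eq_sum_taylor (Q : ℚ[X]) (D : ℕ) :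
    hilbertPoly Q D = ∑ j ∈ Finset.range D,
      C ((-1 : ℚ) ^ j * (taylor 1 Q).coeff j) * preHilbertPoly ℚ (D - j - 1) 0 := by
  let N := max D ((taylor 1 Q).natDegree + 1)
  have hQ : Q = ∑ j ∈ Finset.range N, ((-1 : ℚ) ^ j * (taylor 1 Q).coeff j) • (1 - X) ^ j := by
    conv_lhs => rw [← sum_taylor_eq Q 1]
    rw [Polynomial.sum_over_range' _ (by simp) N (by omega)]
    refine Finset.sum_congr rfl fun j _ => ?_
    rw [C_1, ← neg_sub (1 : ℚ[X]) X, neg_pow, smul_eq_C_mul, C_mul, C_pow, C_neg, C_1]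
    ring
  have hlin : hilbertPoly Q D = hilbertPoly_linearMap ℚ D Q := rfl
  rw [hlin]
  conv_lhs => rw [hQ]
  rw [map_sum, ← Finset.sum_subset (Finset.range_subset_range.2 (le_max_left D _))]
  · refine Finset.sum_congr rfl fun j hj => ?_
    rw [map_smul]
    change _ • hilbertPoly _ _ = _
    rw [hilbertPoly_one_sub_X_pow, if_pos (Finset.mem_range.1 hj), smul_eq_C_mul]
  · intro j _ hj
    rw [map_smul]
    change _ • hilbertPoly _ _ = _
    rw [hilbertPoly_one_sub_X_pow, if_neg (fun h => hj (Finset.mem_range.2 h)), smul_zero]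

variable {R : Type*} [CommRing R] [Module R M]

/-- Dividing by `(1 - X) ^ i` turns the Hilbert series into `Q / (1 - X) ^ (n + i)`. Expanding `Q`
in powers of `1 - X` then gives the required binomial form; integrality holds because `Q` and the
centre `1` are integral. -/
theorem isHilbertCoeffs_of_series {𝓜 : ℕ → Submodule K M} {n : ℕ} (hdim : moduleDim R M = n)
    {Q : ℤ[X]} (hQ : (1 - PowerSeries.X) ^ n *
      PowerSeries.mk (fun k => (Module.finrank K (𝓜 k) : ℤ)) = (Q : PowerSeries ℤ)) (i : ℕ) :
    IsHilbertCoeffs R 𝓜 i (fun j => if j < n + i then (taylor 1 Q).coeff j else 0) := by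
  refine ⟨?_, fun j hj => if_neg (by omega)⟩
  let Q' := Q.map (Int.castRingHom ℚ)
  have hpoly : (∑ j ∈ Finset.range (moduleDim R M + i), C ((-1 : ℚ) ^ j *
      ((if j < n + i then (taylor 1 Q).coeff j else 0 : ℤ) : ℚ)) *
        preHilbertPoly ℚ (moduleDim R M + i - j - 1) 0) = hilbertPoly Q' (n + i) := by
    rw [hilbertPoly_eq_sum_taylor, hdim]
    refine Finset.sum_congr rfl fun j hj => ?_
    have h1 : taylor 1 Q' = (taylor 1 Q).map (Int.castRingHom ℚ) := by
      rw [taylor_apply, taylor_apply, Polynomial.map_comp]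
      simp [Q']
    rw [if_pos (Finset.mem_range.1 hj), h1, coeff_map]
    rfl
  rw [hpoly]
  filter_upwards [eventually_gt_atTop Q'.natDegree] with k hk
  rw [← coeff_mul_invOneSubPow_eq_hilbertPoly_eval _ hk]
  rw [← one_sub_X_pow_mul_mk_iteratedHilbertFunction 𝓜 i, ← mul_assoc, ← pow_add] at hQ
  have h2 := congrArg (PowerSeries.map (Int.castRingHom ℚ)) hQ
  rw [map_mul, map_pow, map_sub, map_one, PowerSeries.map_X, ← Polynomial.polynomial_map_coe] at h2
  rw [← h2, mul_right_comm, ← PowerSeries.invOneSubPow_inv_eq_one_sub_pow]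
  simp

theorem eq_of_eventually_eval_eq {P Q : ℚ[X]}
    (h : ∀ᶠ k : ℕ in atTop, P.eval (k : ℚ) = Q.eval (k : ℚ)) : P = Q := by
  obtain ⟨N, hN⟩ := eventually_atTop.1 h
  refine eq_of_infinite_eval_eq P Q
    (((Set.Ici_infinite N).image Nat.cast_injective.injOn).mono ?_)
  rintro _ ⟨k, hk, rfl⟩
  exact hN k hk

/-- The binomial polynomials in the expansion have pairwise distinct degrees, hence are linearly
independent. -/
theorem IsHilbertCoeffs.unique {𝓜 : ℕ → Submodule K M} {i : ℕ} {e e' : ℕ → ℤ}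
    (h : IsHilbertCoeffs R 𝓜 i e) (h' : IsHilbertCoeffs R 𝓜 i e') : e = e' := by
  set D := moduleDim R M + i with hD
  let T : Polynomial.Sequence ℚ :=
    ⟨fun d => preHilbertPoly ℚ d 0, fun d => by
      rw [degree_eq_natDegree, natDegree_preHilbertPoly]
      intro h0
      have := coeff_preHilbertPoly_self ℚ d 0
      rw [h0, coeff_zero] at this
      exact (inv_ne_zero (Nat.cast_ne_zero.2 d.factorial_ne_zero)) this.symm⟩
  have hT := T.linearIndependent
  have heq := eq_of_eventually_eval_eq
    (h.1.and h'.1 |>.mono fun k hk => hk.1.symm.trans hk.2)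
  funext j
  rcases lt_or_ge j D with hj | hj
  · rw [← sub_eq_zero, ← Finset.sum_sub_distrib] at heq
    have h1 : ∑ d ∈ Finset.range D,
        ((-1 : ℚ) ^ (D - 1 - d) * (e (D - 1 - d) - e' (D - 1 - d))) • T d = 0 := by
      rw [← heq, ← hD, ← Finset.sum_range_reflect]
      refine Finset.sum_congr rfl fun d hd => ?_
      have hd' := Finset.mem_range.1 hd
      change (_ : ℚ) • preHilbertPoly ℚ (D - 1 - d) 0 = _
      rw [smul_eq_C_mul, show D - 1 - (D - 1 - d) = d by omega,
        show D - 1 - d = D - d - 1 by omega, ← sub_mul, ← C_sub, mul_sub]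
    have h2 := linearIndependent_iff'.1 hT _ _ h1 (D - 1 - j) (Finset.mem_range.2 (by omega))
    rw [show D - 1 - (D - 1 - j) = j by omega] at h2
    have h3 := (mul_eq_zero.1 h2).resolve_left (pow_ne_zero _ (by norm_num))
    exact_mod_cast sub_eq_zero.1 h3
  · rw [h.2 j hj, h'.2 j hj]

theorem isHilbertCoeffs_hilbertCoeff {𝓜 : ℕ → Submodule K M} {i : ℕ} {e : ℕ → ℤ}
    (h : IsHilbertCoeffs R 𝓜 i e) : IsHilbertCoeffs R 𝓜 i (fun j => hilbertCoeff R 𝓜 i j) := by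
  have h' : ∃ e, IsHilbertCoeffs R 𝓜 i e := ⟨e, h⟩
  simp only [hilbertCoeff, dif_pos h']
  exact h'.choose_spec

theorem IsHilbertCoeffs.hilbertCoeff_eq {𝓜 : ℕ → Submodule K M} {i : ℕ} {e : ℕ → ℤ}
    (h : IsHilbertCoeffs R 𝓜 i e) (j : ℕ) : hilbertCoeff R 𝓜 i j = e j :=
  congrFun ((isHilbertCoeffs_hilbertCoeff h).unique h) j

theorem isHilbertCoeffs_zero_of_subsingleton [Subsingleton M] (𝓜 : ℕ → Submodule K M) (i : ℕ) :
    IsHilbertCoeffs R 𝓜 i 0 := by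
  have hdim : moduleDim R M = 0 := by
    simp [moduleDim, Module.supportDim_eq_bot_of_subsingleton]
  have h := isHilbertCoeffs_of_series (𝓜 := 𝓜) hdim (Q := 0)
    (by ext; simp [Subsingleton.elim (𝓜 _) ⊥]) i
  simpa [← Pi.zero_def] using h

end HilbertCoefficients

/-- A nonzero ideal of a domain is a faithful module, so its dimension is that of the ring. This
makes the range of `j` the same for all powers. -/
theorem moduleDim_ideal {K : Type*} [Field K] {n : ℕ} {J : Ideal (MvPolynomial (Fin n) K)}
    (hJ : J ≠ ⊥) : moduleDim (MvPolynomial (Fin n) K) J = n := by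
  have hann : Module.annihilator (MvPolynomial (Fin n) K) J = ⊥ := by
    obtain ⟨x, hx, hx0⟩ := Submodule.exists_mem_ne_zero_of_ne_bot hJ
    rw [eq_bot_iff]
    intro a ha
    have := congrArg Subtype.val (Module.mem_annihilator.1 ha ⟨x, hx⟩)
    simpa [hx0] using this
  rw [moduleDim, Module.supportDim_eq_ringKrullDim_quotient_annihilator, hann,
    ringKrullDim_eq_of_ringEquiv (RingEquiv.quotientBot _),
    MvPolynomial.ringKrullDim_of_isNoetherianRing, ringKrullDim_eq_zero_of_field]
  simp

/-! ### Growth of powers of a subspace in a finitely generated algebra. -/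

section Growth

/-- Lying over lifts the first prime of a chain, and going up lifts the rest. -/
theorem ringKrullDim_le_of_isIntegral_of_injective {R S : Type*} [CommRing R] [CommRing S]
    [Algebra R S] [Algebra.IsIntegral R S] [FaithfulSMul R S] :
    ringKrullDim R ≤ ringKrullDim S := by
  refine iSup_le fun l => ?_
  obtain ⟨⟨P, hP, hPl⟩⟩ := Ideal.nonempty_primesOver (S := S) l.head.asIdeal
  obtain ⟨L, hL, -⟩ := Ideal.exists_ltSeries_of_hasGoingUp l P
  rw [← hL]
  exact Order.LTSeries.length_le_krullDim L

theorem natCast_le_ringKrullDim_of_injective_of_finite {K F : Type*} [Field K] [CommRing F]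
    [Algebra K F] {s : ℕ} (g : MvPolynomial (Fin s) K →ₐ[K] F) (hg : Function.Injective g)
    (hfin : g.Finite) : (s : WithBot ℕ∞) ≤ ringKrullDim F := by
  let _ := g.toRingHom.toAlgebra
  have h1 : Module.Finite (MvPolynomial (Fin s) K) F := hfin
  have h2 : FaithfulSMul (MvPolynomial (Fin s) K) F :=
    (faithfulSMul_iff_algebraMap_injective _ _).2 hg
  have h3 := ringKrullDim_le_of_isIntegral_of_injective (R := MvPolynomial (Fin s) K) (S := F)
  rw [MvPolynomial.ringKrullDim_of_isNoetherianRing, ringKrullDim_eq_zero_of_field] at h3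
  simpa using h3

theorem finrank_restrictTotalDegree_le (K : Type*) [Field K] (s e : ℕ) :
    Module.finrank K (MvPolynomial.restrictTotalDegree (Fin s) K e) ≤ (e + 1) ^ s := by
  have hinj : Function.Injective (fun (a : {a : Fin s →₀ ℕ | (a.sum fun _ e => e) ≤ e}) i =>
      (⟨a.1 i, Nat.lt_succ_of_le (le_trans (by
        rw [Finsupp.sum_fintype _ _ fun _ => rfl]
        exact Finset.single_le_sum (f := a.1) (fun _ _ => Nat.zero_le _) (Finset.mem_univ i))
        a.2)⟩ : Fin (e + 1))) := by
    intro a b hab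
    refine Subtype.ext (Finsupp.ext fun i => ?_)
    exact congrArg Fin.val (congrFun hab i)
  have h1 : Module.finrank K (MvPolynomial.restrictTotalDegree (Fin s) K e) =
      Nat.card {a : Fin s →₀ ℕ | (a.sum fun _ e => e) ≤ e} :=
    Module.finrank_eq_nat_card_basis (MvPolynomial.basisRestrictSupport K _)
  rw [h1]
  refine (Nat.card_le_card_of_injective _ hinj).trans ?_
  simp

theorem finrank_mul_le {K F : Type*} [Field K] [CommRing F] [Algebra K F] (P U : Submodule K F)
    [FiniteDimensional K P] [FiniteDimensional K U] :
    Module.finrank K (P * U : Submodule K F) ≤ Module.finrank K P * Module.finrank K U := by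
  rw [← Submodule.mulMap_range, ← Module.finrank_tensorProduct]
  exact LinearMap.finrank_range_le _

/-- The powers of a finite-dimensional subspace of an algebra that is finite over a polynomial
ring in `s` variables have dimension `O(k ^ s)`. -/
theorem exists_finrank_pow_le_of_finite {K F : Type*} [Field K] [CommRing F] [Algebra K F] {s : ℕ}
    (g : MvPolynomial (Fin s) K →ₐ[K] F) (hfin : g.Finite) (V : Submodule K F)
    [FiniteDimensional K V] :
    ∃ c : ℕ, ∀ k, Module.finrank K (V ^ k : Submodule K F) ≤ c * (k + 1) ^ s := by
  let _ := g.toRingHom.toAlgebra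
  have h1 : Module.Finite (MvPolynomial (Fin s) K) F := hfin
  obtain ⟨t, ht⟩ := h1.fg_top
  let P : ℕ → Submodule K F := fun e =>
    (MvPolynomial.restrictTotalDegree (Fin s) K e).map g.toLinearMap
  let U : Submodule K F := Submodule.span K t
  have hU : FiniteDimensional K U := FiniteDimensional.span_finset K t
  have hP : ∀ e, FiniteDimensional K (P e) := fun e => inferInstance
  have hmul : ∀ a b, P a * P b ≤ P (a + b) := by
    intro a b
    rw [Submodule.mul_le]
    rintro _ ⟨x, hx, rfl⟩ _ ⟨y, hy, rfl⟩
    refine ⟨x * y, ?_, by simp⟩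
    rw [SetLike.mem_coe, MvPolynomial.mem_restrictTotalDegree] at *
    exact (MvPolynomial.totalDegree_mul x y).trans (add_le_add hx hy)
  have hmono : Monotone P := by
    intro a b hab
    refine Submodule.map_mono fun x hx => ?_
    rw [MvPolynomial.mem_restrictTotalDegree] at *
    exact hx.trans hab
  have hmono' : Monotone (fun e => P e * U) := fun a b hab => mul_le_mul' (hmono hab) le_rfl
  have hmem : ∀ y : F, ∃ e, y ∈ P e * U := by
    intro y
    have hy : y ∈ Submodule.span (MvPolynomial (Fin s) K) (t : Set F) := ht ▸ Submodule.mem_top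
    induction hy using Submodule.span_induction with
    | zero => exact ⟨0, Submodule.zero_mem _⟩
    | mem x hx =>
      refine ⟨0, ?_⟩
      rw [← one_mul x]
      refine Submodule.mul_mem_mul ⟨1, ?_, by simp⟩ (Submodule.subset_span hx)
      rw [SetLike.mem_coe, MvPolynomial.mem_restrictTotalDegree]
      simp
    | add x y _ _ hx hy =>
      obtain ⟨a, ha⟩ := hx
      obtain ⟨b, hb⟩ := hy
      exact ⟨max a b, Submodule.add_mem _ (hmono' (le_max_left a b) ha)
        (hmono' (le_max_right a b) hb)⟩
    | smul b x _ hx =>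
      obtain ⟨a, ha⟩ := hx
      refine ⟨b.totalDegree + a, ?_⟩
      have h2 : g b ∈ P b.totalDegree :=
        ⟨b, (MvPolynomial.mem_restrictTotalDegree _ _ _).2 le_rfl, rfl⟩
      have h3 := Submodule.mul_mem_mul h2 ha
      rw [← mul_assoc] at h3
      exact (mul_le_mul' (hmul _ _) le_rfl : _ * U ≤ _ * U) h3
  have hsub : ∀ W : Submodule K F, W.FG → ∃ e, W ≤ P e * U := by
    rintro W ⟨t', rfl⟩
    choose d hd using hmem
    exact ⟨t'.sup d, Submodule.span_le.2 fun x hx => hmono' (Finset.le_sup (f := d) hx) (hd x)⟩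
  obtain ⟨d₁, hd₁⟩ := hsub V (Module.Finite.iff_fg.1 inferInstance)
  obtain ⟨d₂, hd₂⟩ := hsub (U * U)
    ((Module.Finite.iff_fg.1 inferInstance).mul (Module.Finite.iff_fg.1 inferInstance))
  obtain ⟨d₃, hd₃⟩ := hsub 1 ⟨{1}, by simp [Submodule.one_eq_span]⟩
  -- The unit costs degree `d₃`. Each further factor `V` costs `d₁` for writing `V` inside `P d₁ *
  -- U`, and `d₂` for reducing `U * U` to `P d₂ * U`.
  have hpow : ∀ k, V ^ k ≤ P (d₃ + (d₁ + d₂) * k) * U := by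
    intro k
    induction k with
    | zero => simpa using hd₃
    | succ k ih =>
      rw [pow_succ']
      calc V * V ^ k ≤ (P d₁ * U) * (P (d₃ + (d₁ + d₂) * k) * U) := mul_le_mul' hd₁ ih
        _ = (P d₁ * P (d₃ + (d₁ + d₂) * k)) * (U * U) := by ring
        _ ≤ P (d₁ + (d₃ + (d₁ + d₂) * k)) * (P d₂ * U) := mul_le_mul' (hmul _ _) hd₂
        _ = (P (d₁ + (d₃ + (d₁ + d₂) * k)) * P d₂) * U := by ring
        _ ≤ P (d₁ + (d₃ + (d₁ + d₂) * k) + d₂) * U := mul_le_mul' (hmul _ _) le_rfl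
        _ = P (d₃ + (d₁ + d₂) * (k + 1)) * U := by congr 2; ring
  refine ⟨(d₃ + d₁ + d₂ + 1) ^ s * Module.finrank K U, fun k => ?_⟩
  have hPU : FiniteDimensional K (P (d₃ + (d₁ + d₂) * k) * U : Submodule K F) :=
    Module.Finite.iff_fg.2
      ((Module.Finite.iff_fg.1 inferInstance).mul (Module.Finite.iff_fg.1 inferInstance))
  calc Module.finrank K (V ^ k : Submodule K F)
      ≤ Module.finrank K (P (d₃ + (d₁ + d₂) * k) * U : Submodule K F) :=
        Submodule.finrank_mono (hpow k)
    _ ≤ Module.finrank K (P (d₃ + (d₁ + d₂) * k)) * Module.finrank K U := finrank_mul_le _ _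
    _ ≤ (d₃ + (d₁ + d₂) * k + 1) ^ s * Module.finrank K U := by
        gcongr
        exact (Submodule.finrank_map_le _ _).trans (finrank_restrictTotalDegree_le K s _)
    _ ≤ ((d₃ + d₁ + d₂ + 1) * (k + 1)) ^ s * Module.finrank K U := by
        gcongr
        nlinarith
    _ = _ := by rw [mul_pow]; ring

/-- The powers of a finite-dimensional subspace of a finitely generated algebra of Krull
dimension `s` have dimension `O(k ^ s)`. -/
theorem exists_finrank_pow_le (K F : Type*) [Field K] [CommRing F] [Nontrivial F] [Algebra K F]
    [Algebra.FiniteType K F] :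
    ∃ s : ℕ, (s : WithBot ℕ∞) ≤ ringKrullDim F ∧ ∀ (V : Submodule K F) [FiniteDimensional K V],
      ∃ c : ℕ, ∀ k, Module.finrank K (V ^ k : Submodule K F) ≤ c * (k + 1) ^ s := by
  obtain ⟨s, g, hg, hfin⟩ := exists_finite_inj_algHom_of_fg K F
  exact ⟨s, natCast_le_ringKrullDim_of_injective_of_finite g hg hfin,
    fun V _ => exists_finrank_pow_le_of_finite g hfin V⟩

end Growth

/-! ### The fiber ring and the components of bidegree `(0, k)`. -/

section FiberRing

variable {K : Type*} [Field K] {n r : ℕ}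

/-- The ideal `𝔪 ℛ(I)` of the Rees ring. -/
abbrev fiberIdeal (I : Ideal (MvPolynomial (Fin n) K)) : Ideal (reesAlgebra I) :=
  (MvPolynomial.idealOfVars (Fin n) K).map (algebraMap (MvPolynomial (Fin n) K) (reesAlgebra I))

theorem span_le_idealOfVars_pow {f : Fin r → MvPolynomial (Fin n) K} {p : ℕ}
    (hf : ∀ j, (f j).IsHomogeneous p) :
    Ideal.span (Set.range f) ≤ MvPolynomial.idealOfVars (Fin n) K ^ p := by
  rw [Ideal.span_le]
  rintro _ ⟨j, rfl⟩
  rw [SetLike.mem_coe, MvPolynomial.mem_pow_idealOfVars_iff']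
  intro x hx
  exact (hf j).coeff_eq_zero hx.ne

/-- The coefficient of `t ^ j` in an element of `𝔪ℛ(I)` lies in `𝔪 I ^ j`, and `I ≤ 𝔪 ^ p`. Hence a
nonzero form of degree `p * j` cannot occur there, which makes the forms of least degree in the
powers survive in the fiber ring. -/
theorem coeff_mem_of_mem_fiberIdeal {I : Ideal (MvPolynomial (Fin n) K)} {p : ℕ}
    (hI : I ≤ MvPolynomial.idealOfVars (Fin n) K ^ p) {y : reesAlgebra I}
    (hy : y ∈ fiberIdeal I) (j : ℕ) :
    (y : (MvPolynomial (Fin n) K)[X]).coeff j ∈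
      MvPolynomial.idealOfVars (Fin n) K ^ (p * j + 1) := by
  induction hy using Submodule.span_induction generalizing j with
  | zero => simp
  | add a b _ _ ha hb => exact Ideal.add_mem _ (ha j) (hb j)
  | mem x hx =>
    obtain ⟨x, hx, rfl⟩ := hx
    change (C x).coeff j ∈ _
    rw [coeff_C]
    split_ifs with h
    · subst h
      simpa using hx
    · exact Ideal.zero_mem _
  | smul a x _ hx =>
    change ((a : (MvPolynomial (Fin n) K)[X]) * x).coeff j ∈ _
    rw [coeff_mul]
    refine Ideal.sum_mem _ fun ij hij => ?_
    rw [← Finset.HasAntidiagonal.mem_antidiagonal.1 hij, mul_add, add_assoc, pow_add]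
    refine Ideal.mul_mem_mul ?_ (hx _)
    rw [pow_mul]
    exact Ideal.pow_right_mono hI _ (a.2 _)

theorem eq_zero_of_isHomogeneous_of_mem {w : MvPolynomial (Fin n) K} {d : ℕ}
    (hw : w.IsHomogeneous d) (hw' : w ∈ MvPolynomial.idealOfVars (Fin n) K ^ (d + 1)) :
    w = 0 := by
  ext x
  rw [MvPolynomial.coeff_zero]
  by_cases h : x.degree = d
  · exact (MvPolynomial.mem_pow_idealOfVars_iff' _ _).1 hw' x (by omega)
  · exact hw.coeff_eq_zero h

/-- The fiber ring `ℛ(I) / 𝔪 ℛ(I)`. -/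
def FiberRing (I : Ideal (MvPolynomial (Fin n) K)) : Type _ := reesAlgebra I ⧸ fiberIdeal I

instance (I : Ideal (MvPolynomial (Fin n) K)) : CommRing (FiberRing I) :=
  inferInstanceAs (CommRing (reesAlgebra I ⧸ fiberIdeal I))

instance (I : Ideal (MvPolynomial (Fin n) K)) : Algebra K (FiberRing I) :=
  inferInstanceAs (Algebra K (reesAlgebra I ⧸ fiberIdeal I))

/-- The projection of the Rees ring onto the fiber ring. -/
def FiberRing.mk (I : Ideal (MvPolynomial (Fin n) K)) : reesAlgebra I →ₐ[K] FiberRing I :=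
  Ideal.Quotient.mkₐ K (fiberIdeal I)

instance (I : Ideal (MvPolynomial (Fin n) K)) : Nontrivial (FiberRing I) := by
  change Nontrivial (reesAlgebra I ⧸ fiberIdeal I)
  rw [Ideal.Quotient.nontrivial_iff, Ne, Ideal.eq_top_iff_one]
  intro h
  -- With `p = 0` the containment is vacuous, so this works for every ideal: the constant
  -- coefficient `1` would lie in `𝔪`.
  have h1 := coeff_mem_of_mem_fiberIdeal (p := 0) (by simp) h 0
  have h2 := eq_zero_of_isHomogeneous_of_mem (d := 0) (w := (1 : MvPolynomial (Fin n) K))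
    (MvPolynomial.isHomogeneous_one _ _) (by simpa using h1)
  exact one_ne_zero h2

instance (I : Ideal (MvPolynomial (Fin n) K)) : Algebra.FiniteType K (FiberRing I) := by
  have h1 : Algebra.FiniteType (MvPolynomial (Fin n) K) (reesAlgebra I) :=
    (reesAlgebra I).fg_iff_finiteType.1 (reesAlgebra.fg (IsNoetherian.noetherian I))
  have h2 : Algebra.FiniteType K (reesAlgebra I) := Algebra.FiniteType.trans
    (inferInstance : Algebra.FiniteType K (MvPolynomial (Fin n) K)) h1
  exact Algebra.FiniteType.of_surjective (FiberRing.mk I)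
    (Ideal.Quotient.mkₐ_surjective _ _)

theorem mem_bidegreeSpan_zero {f : Fin r → MvPolynomial (Fin n) K} {p : ℕ}
    (hf : ∀ j, (f j).IsHomogeneous p) {k : ℕ} {w : MvPolynomial (Fin n) K}
    (hw : w ∈ bidegreeSpan K (reesGenerators f) 0 k) :
    w ∈ Ideal.span (Set.range f) ^ k ∧ w.IsHomogeneous (p * k) := by
  have h := restrictScalars_span_pow_inf f hf k (p * k)
  rw [if_pos le_rfl, Nat.sub_self] at h
  rw [← h] at hw
  exact hw

/-- The embedding of the forms `w` of degree `p * k` in `I ^ k` into the fiber ring,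
sending `w` to the class of `w t ^ k`. -/
def toFiberRing {f : Fin r → MvPolynomial (Fin n) K} {p : ℕ}
    (hf : ∀ j, (f j).IsHomogeneous p) (k : ℕ) :
    bidegreeSpan K (reesGenerators f) 0 k →ₗ[K] reesAlgebra (Ideal.span (Set.range f)) where
  toFun w := ⟨monomial k w.1, reesAlgebra.monomial_mem.2 (mem_bidegreeSpan_zero hf w.2).1⟩
  map_add' _ _ := Subtype.ext (map_add _ _ _)
  map_smul' a w := Subtype.ext (Polynomial.smul_monomial a k w.1).symm

theorem coe_toFiberRing {f : Fin r → MvPolynomial (Fin n) K} {p : ℕ}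
    (hf : ∀ j, (f j).IsHomogeneous p) (k : ℕ) (w : bidegreeSpan K (reesGenerators f) 0 k) :
    (toFiberRing hf k w : (MvPolynomial (Fin n) K)[X]) = monomial k w.1 := rfl

/-- The element `f_i t` of the Rees algebra. -/
def reesDegreeOne (f : Fin r → MvPolynomial (Fin n) K) (i : Fin r) :
    reesAlgebra (Ideal.span (Set.range f)) :=
  ⟨monomial 1 (f i), reesAlgebra.monomial_mem.2 (by
    rw [pow_one]; exact Ideal.subset_span (Set.mem_range_self i))⟩

/-- The space spanned by `1` and the generators of the fiber ring. -/
def fiberGenerators (f : Fin r → MvPolynomial (Fin n) K) :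
    Submodule K (FiberRing (Ideal.span (Set.range f))) :=
  Submodule.span K (insert 1 (Set.range fun i => FiberRing.mk _ (reesDegreeOne f i)))

instance (f : Fin r → MvPolynomial (Fin n) K) : FiniteDimensional K (fiberGenerators f) :=
  FiniteDimensional.span_of_finite K ((Set.finite_range _).insert _)

theorem prod_mem_prod_submodule {F : Type*} [CommRing F] [Algebra K F] {x : Fin r → F}
    {V : Fin r → Submodule K F} (h : ∀ j, x j ∈ V j) : ∏ j, x j ∈ ∏ j, V j := by
  induction r with
  | zero => simp [Submodule.one_eq_span, Submodule.mem_span_singleton_self]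
  | succ r ih =>
    rw [Fin.prod_univ_succ, Fin.prod_univ_succ]
    exact Submodule.mul_mem_mul (h 0) (ih fun j => h j.succ)

theorem mk_toFiberRing_mem {f : Fin r → MvPolynomial (Fin n) K} {p : ℕ}
    (hf : ∀ j, (f j).IsHomogeneous p) (k : ℕ) (w : bidegreeSpan K (reesGenerators f) 0 k) :
    FiberRing.mk _ (toFiberRing hf k w) ∈
      fiberGenerators f ^ k := by
  obtain ⟨w, hw⟩ := w
  rw [bidegreeSpan] at hw
  induction hw using Submodule.span_induction with
  | zero =>
    have : (⟨0, Submodule.zero_mem _⟩ : bidegreeSpan K (reesGenerators f) 0 k) = 0 := rfl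
    rw [this, map_zero, map_zero]
    exact Submodule.zero_mem _
  | add a b ha hb iha ihb =>
    have : (⟨a + b, Submodule.add_mem _ ha hb⟩ : bidegreeSpan K (reesGenerators f) 0 k) =
      ⟨a, ha⟩ + ⟨b, hb⟩ := rfl
    rw [this, map_add, map_add]
    exact Submodule.add_mem _ (iha ha) (ihb hb)
  | smul a x hx ihx =>
    have : (⟨a • x, Submodule.smul_mem _ a hx⟩ : bidegreeSpan K (reesGenerators f) 0 k) =
      a • ⟨x, hx⟩ := rfl
    rw [this, map_smul, map_smul]
    exact Submodule.smul_mem _ a (ihx hx)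
  | mem x hx =>
    obtain ⟨c, hc, rfl⟩ := hx
    obtain ⟨hc1, hc2⟩ := mem_bidegreeFinset.1 hc
    have h0 : ∀ i, c (Fin.castAdd r i) = 0 := by simpa using hc1
    have h1 : monom (reesGenerators f) c = monom f (fun j => c (Fin.natAdd n j)) := by
      rw [reesGenerators, monom_append]
      simp [h0, monom]
    have h2 : toFiberRing hf k ⟨_, Submodule.subset_span ⟨c, hc, rfl⟩⟩ =
        ∏ j, reesDegreeOne f j ^ c (Fin.natAdd n j) := by
      apply Subtype.ext
      rw [coe_toFiberRing, ← Subalgebra.coe_val, map_prod]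
      simp only [map_pow, Subalgebra.coe_val, reesDegreeOne, ← C_mul_X_pow_eq_monomial, pow_one,
        mul_pow, Finset.prod_mul_distrib, Finset.prod_pow_eq_pow_sum, hc2, h1]
      simp [monom]
    rw [h2, map_prod, ← hc2, ← Finset.prod_pow_eq_pow_sum]
    refine prod_mem_prod_submodule fun j => ?_
    rw [map_pow]
    exact Submodule.pow_mem_pow _
      (Submodule.subset_span (Set.mem_insert_of_mem _ (Set.mem_range_self j))) _

/-- The components with `j ≤ k` sit in different powers of `t` and inject jointly into the fiber
ring. Because `1` is among the generators, the powers of `fiberGenerators f` increase and the `k`th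
one contains all these images. -/
theorem sum_finrank_le_finrank_fiberGenerators_pow {f : Fin r → MvPolynomial (Fin n) K} {p : ℕ}
    (hf : ∀ j, (f j).IsHomogeneous p) (k : ℕ) :
    ∑ j ∈ Finset.range (k + 1), Module.finrank K (bidegreeSpan K (reesGenerators f) 0 j) ≤
      Module.finrank K (fiberGenerators f ^ k : Submodule K _) := by
  let Ψ : (∀ j : Fin (k + 1), bidegreeSpan K (reesGenerators f) 0 j) →ₗ[K]
      reesAlgebra (Ideal.span (Set.range f)) :=
    ∑ j : Fin (k + 1), toFiberRing hf j ∘ₗ LinearMap.proj j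
  let Φ := (FiberRing.mk (Ideal.span (Set.range f))).toLinearMap ∘ₗ Ψ
  have hone : (1 : Submodule K _) ≤ fiberGenerators f := by
    rw [Submodule.one_le]
    exact Submodule.subset_span (Set.mem_insert _ _)
  have hmem : ∀ w, Φ w ∈ fiberGenerators f ^ k := by
    intro w
    simp only [Φ, Ψ, LinearMap.comp_apply, LinearMap.sum_apply, map_sum]
    exact Submodule.sum_mem _ fun j _ =>
      pow_right_mono₀ hone (Nat.le_of_lt_succ j.2) (mk_toFiberRing_mem hf j (w j))
  have hcoeff : ∀ w (j : Fin (k + 1)),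
      (Ψ w : (MvPolynomial (Fin n) K)[X]).coeff j = (w j : MvPolynomial (Fin n) K) := by
    intro w j
    simp only [Ψ, LinearMap.sum_apply, LinearMap.comp_apply, LinearMap.proj_apply]
    rw [← Subalgebra.coe_val, map_sum, finsetSum_coeff, Finset.sum_eq_single j]
    · simp [coe_toFiberRing]
    · intro i _ hij
      rw [Subalgebra.coe_val, coe_toFiberRing, coeff_monomial,
        if_neg (fun h => hij (Fin.ext h))]
    · simp
  have hinj : Function.Injective (Φ.codRestrict (fiberGenerators f ^ k) hmem) := by
    rw [← LinearMap.ker_eq_bot, LinearMap.ker_codRestrict, LinearMap.ker_eq_bot']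
    intro w hw
    have hw' : Ψ w ∈ fiberIdeal (Ideal.span (Set.range f)) := Ideal.Quotient.eq_zero_iff_mem.1 hw
    funext j
    apply Subtype.ext
    have h1 := coeff_mem_of_mem_fiberIdeal (span_le_idealOfVars_pow hf) hw' j
    rw [hcoeff] at h1
    exact eq_zero_of_isHomogeneous_of_mem (mem_bidegreeSpan_zero hf (w j).2).2 h1
  have hfin : FiniteDimensional K (fiberGenerators f ^ k : Submodule K _) :=
    Module.Finite.iff_fg.2 ((Module.Finite.iff_fg.1 inferInstance).pow k)
  have h := LinearMap.finrank_le_finrank_of_injective hinj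
  rw [Module.finrank_pi_fintype] at h
  rwa [Finset.sum_range]

theorem exists_sum_finrank_le_pow {f : Fin r → MvPolynomial (Fin n) K} {p : ℕ}
    (hf : ∀ j, (f j).IsHomogeneous p) :
    ∃ s : ℕ, (s : WithBot ℕ∞) ≤ analyticSpread (Ideal.span (Set.range f)) ∧ ∃ c : ℕ, ∀ k,
      ∑ j ∈ Finset.range (k + 1), Module.finrank K (bidegreeSpan K (reesGenerators f) 0 j) ≤
        c * (k + 1) ^ s := by
  obtain ⟨s, hs, h⟩ := exists_finrank_pow_le K (FiberRing (Ideal.span (Set.range f)))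
  obtain ⟨c, hc⟩ := h (fiberGenerators f)
  exact ⟨s, hs, c, fun k => (sum_finrank_le_finrank_fiberGenerators_pow hf k).trans (hc k)⟩

/-- `bidegreeSpan m k` is spanned by the products of forms of degree `m` with elements of
`bidegreeSpan 0 k`. -/
theorem exists_finrank_bidegreeSpan_le (f : Fin r → MvPolynomial (Fin n) K) (m : ℕ) :
    ∃ c : ℕ, ∀ k, Module.finrank K (bidegreeSpan K (reesGenerators f) m k) ≤
      c * Module.finrank K (bidegreeSpan K (reesGenerators f) 0 k) := by
  refine ⟨Module.finrank K (bidegreeSpan K (reesGenerators f) m 0), fun k => ?_⟩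
  have hfin : FiniteDimensional K (bidegreeSpan K (reesGenerators f) m 0 *
      bidegreeSpan K (reesGenerators f) 0 k : Submodule K _) := Module.Finite.iff_fg.2
    ((Module.Finite.iff_fg.1 inferInstance).mul (Module.Finite.iff_fg.1 inferInstance))
  refine (Submodule.finrank_mono (t := bidegreeSpan K (reesGenerators f) m 0 *
    bidegreeSpan K (reesGenerators f) 0 k) ?_).trans (finrank_mul_le _ _)
  refine Submodule.span_le.2 ?_
  rintro _ ⟨c, hc, rfl⟩
  obtain ⟨hc1, hc2⟩ := mem_bidegreeFinset.1 hc
  have h : c = Fin.append (fun i => c (Fin.castAdd r i)) 0 +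
      Fin.append 0 (fun j => c (Fin.natAdd n j)) := by
    funext i
    refine Fin.addCases (fun i => ?_) (fun j => ?_) i <;> simp
  rw [h, monom_add]
  refine Submodule.mul_mem_mul (Submodule.subset_span ⟨_, ?_, rfl⟩)
    (Submodule.subset_span ⟨_, ?_, rfl⟩)
  · rw [Finset.mem_coe, mem_bidegreeFinset]
    simp [hc1]
  · rw [Finset.mem_coe, mem_bidegreeFinset]
    simp [hc2]

end FiberRing

/-! ### From growth bounds to degree bounds. -/

section PolynomialGrowth

/-- A polynomial function dominated by a function whose partial sums are `O(k ^ s)` has degree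
less than `s`. -/
theorem degree_lt_of_sum_le {P : ℚ[X]} {T : ℕ → ℤ} {h : ℕ → ℕ} {s c₁ c₂ : ℕ}
    (hP : ∀ᶠ k : ℕ in atTop, (T k : ℚ) = P.eval (k : ℚ)) (hT : ∀ k, |T k| ≤ c₁ * h k)
    (hsum : ∀ k, ∑ j ∈ Finset.range (k + 1), h j ≤ c₂ * (k + 1) ^ s) : P.degree < s := by
  by_contra! hdeg
  -- If the degree were at least `s`, then `k ^ s` would be bounded by a multiple of `h k` for large
  -- `k`. Summing over the window `[k, 2k)` gives order `k ^ (s + 1)`, against the assumed `O(k ^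
  -- s)`.
  have hO := (Polynomial.isBigO_atTop_of_degree_le (X ^ s) P (by simpa using hdeg)).comp_tendsto
    (tendsto_natCast_atTop_atTop (R := ℚ))
  obtain ⟨A, hA, hO⟩ := hO.exists_pos
  have hev : ∀ᶠ k : ℕ in atTop, (k : ℝ) ^ s ≤ A * c₁ * h k := by
    filter_upwards [hO.bound, hP] with k hk hk'
    simp only [Function.comp_apply, eval_pow, eval_X, ← hk'] at hk
    have h1 : ‖(T k : ℚ)‖ ≤ (c₁ * h k : ℝ) := by
      have h2 : ‖(T k : ℚ)‖ = ((|T k| : ℤ) : ℝ) := by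
        rw [← Rat.norm_cast_real]
        simp
      rw [h2]
      exact_mod_cast hT k
    have h3 : ‖((k : ℚ) ^ s)‖ = (k : ℝ) ^ s := by
      rw [← Rat.norm_cast_real]
      simp
    rw [h3] at hk
    calc (k : ℝ) ^ s ≤ A * ‖(T k : ℚ)‖ := hk
      _ ≤ A * (c₁ * h k) := by gcongr
      _ = _ := by ring
  obtain ⟨N, hN⟩ := eventually_atTop.1 hev
  obtain ⟨k, hk⟩ := exists_nat_gt (max (N : ℝ) (A * c₁ * c₂ * 2 ^ s))
  have hkN : N < k := by exact_mod_cast (le_max_left _ _).trans_lt hk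
  have hk0 : (0 : ℝ) < k := by exact_mod_cast (Nat.zero_le N).trans_lt hkN
  have h1 : (k : ℝ) * (k : ℝ) ^ s ≤ A * c₁ * (c₂ * (2 * k) ^ s) := by
    calc (k : ℝ) * (k : ℝ) ^ s = ∑ j ∈ Finset.Ico k (2 * k), (k : ℝ) ^ s := by
          simp [two_mul]
      _ ≤ ∑ j ∈ Finset.Ico k (2 * k), A * c₁ * h j := by
          refine Finset.sum_le_sum fun j hj => ?_
          have hkj := (Finset.mem_Ico.1 hj).1
          refine le_trans ?_ (hN j (hkN.le.trans hkj))
          gcongr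
      _ ≤ ∑ j ∈ Finset.range (2 * k), A * c₁ * h j := by
          refine Finset.sum_le_sum_of_subset_of_nonneg ?_ fun _ _ _ => by positivity
          rw [Finset.range_eq_Ico]
          exact Finset.Ico_subset_Ico_left (Nat.zero_le _)
      _ = A * c₁ * ((∑ j ∈ Finset.range (2 * k), h j : ℕ) : ℝ) := by
          rw [← Finset.mul_sum]
          push_cast
          rfl
      _ ≤ A * c₁ * (c₂ * (2 * k) ^ s) := by
          gcongr
          have := hsum (2 * k - 1)
          rw [Nat.sub_add_cancel (by omega)] at this
          exact_mod_cast this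
  have h2 : (k : ℝ) ≤ A * c₁ * c₂ * 2 ^ s := by
    rw [mul_pow] at h1
    refine le_of_mul_le_mul_right ?_ (pow_pos hk0 s)
    calc _ ≤ _ := h1
      _ = _ := by ring
  exact absurd ((le_max_right _ _).trans_lt hk) (not_lt.2 h2)

/-- These are the Taylor coefficients at `1` of `X ^ (p * k)`, the source of the summand `j` in the
degree bound. -/
theorem exists_choose_mul_eq_eval (p a : ℕ) :
    ∃ c : ℚ[X], c.natDegree ≤ a ∧ ∀ k : ℕ, ((p * k).choose a : ℚ) = c.eval (k : ℚ) := by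
  refine ⟨C ((a.factorial : ℚ)⁻¹) * (descPochhammer ℚ a).comp (C (p : ℚ) * X), ?_, fun k => ?_⟩
  · refine (natDegree_C_mul_le _ _).trans (natDegree_comp_le.trans ?_)
    rw [descPochhammer_natDegree]
    have h := natDegree_C_mul_le (p : ℚ) X
    rw [natDegree_X] at h
    exact (Nat.mul_le_mul_left a h).trans (mul_one a).le
  · rw [eval_mul, eval_C, eval_comp, eval_mul, eval_C, eval_X, ← Nat.cast_mul,
      descPochhammer_eval_eq_descFactorial, Nat.descFactorial_eq_factorial_mul_choose]
    have : (a.factorial : ℚ) ≠ 0 := Nat.cast_ne_zero.2 a.factorial_ne_zero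
    push_cast
    field_simp

theorem natDegree_add_one_le_of_mem_degreeLT {P : ℚ[X]} {s j : ℕ} {a : WithBot ℕ∞}
    (hP : P ∈ degreeLT ℚ (s + j)) (hs : (s : WithBot ℕ∞) ≤ a) (h0 : P ≠ 0) :
    (P.natDegree : WithBot ℕ∞) + 1 ≤ a + (j : WithBot ℕ∞) := by
  rw [mem_degreeLT, degree_eq_natDegree h0] at hP
  have h1 : P.natDegree + 1 ≤ s + j := by exact_mod_cast hP
  calc (P.natDegree : WithBot ℕ∞) + 1 ≤ (s : WithBot ℕ∞) + j := by exact_mod_cast h1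
    _ ≤ a + j := by gcongr

end PolynomialGrowth

/-! ### Assembling polynomiality and the degree bound. -/

section Main

variable {K : Type*} [Field K] {n r : ℕ}

/-- The Taylor coefficients at `1` of the numerators of the Hilbert series of the powers of an
ideal generated in one degree are eventually polynomial functions, of degree bounded in terms
of the analytic spread. -/
theorem exists_taylor_coeff_eq_eval {f : Fin r → MvPolynomial (Fin n) K} {p : ℕ}
    (hf : ∀ j, (f j).IsHomogeneous p) :
    ∃ (s : ℕ) (Q : ℕ → ℤ[X]), (s : WithBot ℕ∞) ≤ analyticSpread (Ideal.span (Set.range f)) ∧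
      (∀ k, (1 - PowerSeries.X) ^ n * PowerSeries.mk (fun d => (Module.finrank K
        (idealGrading (Ideal.span (Set.range f) ^ k) d) : ℤ)) = (Q k : PowerSeries ℤ)) ∧
      ∀ j, ∃ P ∈ degreeLT ℚ (s + j),
        ∀ᶠ k : ℕ in atTop, ((taylor 1 (Q k)).coeff j : ℚ) = P.eval (k : ℚ) := by
  obtain ⟨s, hs, c₂, hsum⟩ := exists_sum_finrank_le_pow hf
  obtain ⟨ι, _, q, B, b, hb, hq⟩ := exists_finrank_bidegreeSpan (K := K) (reesGenerators f)
  let N : ℕ → ℤ[X] := fun k => ∑ l, B l k • q l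
  refine ⟨s, fun k => X ^ (p * k) * N k, hs, fun k => ?_, ?_⟩
  · rw [mk_finrank_idealGrading f hf, mul_left_comm, hq, Polynomial.coe_mul, Polynomial.coe_pow,
      Polynomial.coe_X]
  have hcoeff : ∀ u, ∃ c : ℕ, ∀ k, |(N k).coeff u| ≤
      c * Module.finrank K (bidegreeSpan K (reesGenerators f) 0 k) := by
    intro u
    choose c hc using exists_finrank_bidegreeSpan_le f
    -- The `u`th coefficient of `N k` is the convolution of `(1 - X) ^ n` with the dimensions in
    -- bidegrees `(m, k)`, `m ≤ u`. Each of these is at most `c m` times the dimension in bidegree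
    -- `(0, k)`.
    refine ⟨∑ ab ∈ Finset.HasAntidiagonal.antidiagonal u,
      (PowerSeries.coeff ab.1 ((1 - PowerSeries.X : PowerSeries ℤ) ^ n)).natAbs * c ab.2,
      fun k => ?_⟩
    rw [← Polynomial.coeff_coe, ← hq, PowerSeries.coeff_mul]
    refine (Finset.abs_sum_le_sum_abs _ _).trans ?_
    rw [Nat.cast_sum, Finset.sum_mul]
    refine Finset.sum_le_sum fun ab _ => ?_
    rw [abs_mul, PowerSeries.coeff_mk, Nat.cast_mul, Int.natCast_natAbs, mul_assoc]
    gcongr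
    rw [abs_of_nonneg (by positivity)]
    exact_mod_cast hc ab.2 k
  have hlin : ∀ v k, (taylor 1 (N k)).coeff v = ∑ l, B l k * (taylor 1 (q l)).coeff v := by
    intro v k
    simp only [N, map_sum, finsetSum_coeff, map_smul, coeff_smul, smul_eq_mul]
  have htaylor : ∀ v, ∃ P : ℚ[X], P.degree < s ∧
      ∀ᶠ k : ℕ in atTop, ((taylor 1 (N k)).coeff v : ℚ) = P.eval (k : ℚ) := by
    intro v
    have hP : ∀ᶠ k : ℕ in atTop, ((taylor 1 (N k)).coeff v : ℚ) =
        (∑ l, b l * C (((taylor 1 (q l)).coeff v : ℤ) : ℚ)).eval (k : ℚ) := by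
      filter_upwards [eventually_all.2 hb] with k hk
      rw [hlin, eval_finsetSum]
      push_cast
      refine Finset.sum_congr rfl fun l _ => ?_
      rw [eval_mul, eval_C, hk]
    refine ⟨_, ?_, hP⟩
    choose c hc using hcoeff
    -- Because the `q l` do not depend on `k`, this bounds the degree of `N k` uniformly. A Taylor
    -- coefficient is then a fixed linear combination of finitely many coefficients of `N k`.
    let U := Finset.univ.sup (fun l => (q l).natDegree)
    refine degree_lt_of_sum_le
      (c₁ := ∑ u ∈ Finset.range (U + 1), ((taylor 1 (X ^ u : ℤ[X])).coeff v).natAbs * c u)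
      hP (fun k => ?_) hsum
    have hdeg : (N k).natDegree < U + 1 := by
      refine Nat.lt_succ_of_le (natDegree_sum_le_of_forall_le _ _ fun l hl => ?_)
      exact (natDegree_smul_le _ _).trans (Finset.le_sup (f := fun l => (q l).natDegree) hl)
    have hexp : (taylor 1 (N k)).coeff v =
        ∑ u ∈ Finset.range (U + 1), (taylor 1 (X ^ u : ℤ[X])).coeff v * (N k).coeff u := by
      conv_lhs => rw [(N k).as_sum_range' _ hdeg]
      rw [map_sum, finsetSum_coeff]
      refine Finset.sum_congr rfl fun u _ => ?_
      rw [← C_mul_X_pow_eq_monomial, taylor_mul, taylor_C, coeff_C_mul, mul_comm]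
    rw [hexp]
    refine (Finset.abs_sum_le_sum_abs _ _).trans ?_
    rw [Nat.cast_sum, Finset.sum_mul]
    refine Finset.sum_le_sum fun u _ => ?_
    rw [abs_mul, Nat.cast_mul, Int.natCast_natAbs, mul_assoc]
    gcongr
    exact hc u k
  choose P hPdeg hP using htaylor
  choose c hcdeg hc using exists_choose_mul_eq_eval p
  intro j
  refine ⟨∑ ab ∈ Finset.HasAntidiagonal.antidiagonal j, c ab.1 * P ab.2,
    Submodule.sum_mem _ fun ab hab => ?_, ?_⟩
  · rw [mem_degreeLT]
    by_cases h0 : P ab.2 = 0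
    · rw [h0, mul_zero, degree_zero]
      exact WithBot.bot_lt_coe _
    · have h1 : (P ab.2).natDegree < s := (natDegree_lt_iff_degree_lt h0).2 (hPdeg _)
      have h2 := Finset.HasAntidiagonal.mem_antidiagonal.1 hab
      have h3 := natDegree_mul_le (p := c ab.1) (q := P ab.2)
      have h4 := hcdeg ab.1
      refine degree_le_natDegree.trans_lt ?_
      exact_mod_cast (by omega : (c ab.1 * P ab.2).natDegree < s + j)
  · have hall : ∀ᶠ k : ℕ in atTop, ∀ v ∈ Finset.range (j + 1),
        ((taylor 1 (N k)).coeff v : ℚ) = (P v).eval (k : ℚ) :=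
      (Filter.eventually_all_finset _).2 fun v _ => hP v
    filter_upwards [hall] with k hk
    -- Substituting `X + 1` turns `X ^ (p * k)` into `(X + 1) ^ (p * k)`, whose coefficients are the
    -- binomials represented by `c`.
    rw [taylor_mul, taylor_X_pow, coeff_mul, eval_finsetSum]
    push_cast
    refine Finset.sum_congr rfl fun ab hab => ?_
    have h2 := Finset.HasAntidiagonal.mem_antidiagonal.1 hab
    rw [eval_mul, ← hk ab.2 (Finset.mem_range.2 (by omega)), ← hc, C_1, coeff_X_add_one_pow]
    simp

end Main

end HilbertCoeff

end

/-- The first part of the conclusion says that the higher iterated Hilbert coefficients of all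
powers of `I` are well defined. In the second part the degree bound is
`deg P ≤ ℓ(I) + j - 1`, with the convention that the zero polynomial has degree `-1`. -/
theorem corollary2p5 {K : Type*} [Field K] {n : ℕ} (I : Ideal (MvPolynomial (Fin n) K))
    (p : ℕ) (hI : HilbertCoeff.IsGeneratedInDegree I p) :
    (∀ i k : ℕ, HilbertCoeff.IsHilbertCoeffs (MvPolynomial (Fin n) K)
      (HilbertCoeff.idealGrading (I ^ k)) i
      (fun j => HilbertCoeff.hilbertCoeff (MvPolynomial (Fin n) K)
        (HilbertCoeff.idealGrading (I ^ k)) i j)) ∧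
    ∀ i j : ℕ, ∃ P : Polynomial ℚ,
      (∀ᶠ k : ℕ in Filter.atTop,
        (HilbertCoeff.hilbertCoeff (MvPolynomial (Fin n) K)
          (HilbertCoeff.idealGrading (I ^ k)) i j : ℚ) = P.eval (k : ℚ)) ∧
      (P ≠ 0 → (P.natDegree : WithBot ℕ∞) + 1 ≤ HilbertCoeff.analyticSpread I + (j : WithBot ℕ∞)) := by
  obtain ⟨r, f, hf, rfl⟩ := hI.exists_fin
  obtain ⟨s, Q, hs, hQ, hcoeff⟩ := HilbertCoeff.exists_taylor_coeff_eq_eval hf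
  have hzero : ∀ k, Ideal.span (Set.range f) ^ k = ⊥ → ∀ i,
      HilbertCoeff.IsHilbertCoeffs (MvPolynomial (Fin n) K)
        (HilbertCoeff.idealGrading (Ideal.span (Set.range f) ^ k)) i 0 := by
    intro k h i
    have : Subsingleton ↥(Ideal.span (Set.range f) ^ k) := by
      rw [h]
      infer_instance
    exact HilbertCoeff.isHilbertCoeffs_zero_of_subsingleton _ i
  have hne : ∀ k, Ideal.span (Set.range f) ^ k ≠ ⊥ → ∀ i,
      HilbertCoeff.IsHilbertCoeffs (MvPolynomial (Fin n) K)
        (HilbertCoeff.idealGrading (Ideal.span (Set.range f) ^ k)) i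
        (fun j => if j < n + i then (taylor 1 (Q k)).coeff j else 0) :=
    fun k h i => HilbertCoeff.isHilbertCoeffs_of_series (HilbertCoeff.moduleDim_ideal h) (hQ k) i
  refine ⟨fun i k => ?_, fun i j => ?_⟩
  · by_cases h : Ideal.span (Set.range f) ^ k = ⊥
    · exact HilbertCoeff.isHilbertCoeffs_hilbertCoeff (hzero k h i)
    · exact HilbertCoeff.isHilbertCoeffs_hilbertCoeff (hne k h i)
  · by_cases h : Ideal.span (Set.range f) = ⊥
    · refine ⟨0, ?_, fun h0 => absurd rfl h0⟩
      -- The exponent `0` must be excluded: the zeroth power of the zero ideal is the whole ring.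
      filter_upwards [eventually_gt_atTop 0] with k hk
      have hk' : Ideal.span (Set.range f) ^ k = ⊥ := by
        rw [h, ← Ideal.zero_eq_bot, zero_pow hk.ne']
      simp [(hzero k hk' i).hilbertCoeff_eq j]
    · have hk : ∀ k, Ideal.span (Set.range f) ^ k ≠ ⊥ := fun k => pow_ne_zero k h
      by_cases hj : j < n + i
      · obtain ⟨P, hP, hev⟩ := hcoeff j
        refine ⟨P, ?_, HilbertCoeff.natDegree_add_one_le_of_mem_degreeLT hP hs⟩
        filter_upwards [hev] with k hev
        rw [(hne k (hk k) i).hilbertCoeff_eq j, if_pos hj, hev]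
      · refine ⟨0, Eventually.of_forall fun k => ?_, fun h0 => absurd rfl h0⟩
        simp [(hne k (hk k) i).hilbertCoeff_eq j, hj]
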